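/- Let $n,k,d$ be natural numbers with $3\le k\le n-1$ and $\max\{k-1,\,n-k+1\}\le d\le n-2$. Then there exists a holomorphic mapping $\Gamma:\mathbb C^n\to\mathbb C^n$ with the following properties. (A1) $\max_{\xi\in\mathbb C^n}\operatorname{rank} D\Gamma(\xi)=k$ (and $1\le k\le n-1$). Write $\Omega^{(k)}=\{\xi\in\mathbb C^n:\operatorname{rank} D\Gamma(\xi)=k\}$. (A2) For every $\xi\in\Omega^{(k)}$ the level set $\{\eta\in\mathbb C^n:\Gamma(\eta)=\Gamma(\xi)\}$ is an affine subspace of $\mathbb C^n$ of dimension $n-k$ (through $\xi$). Moreover, let $\mathbb G_{n-k}(\mathbb C^n)$ be the Grassmannian of $(n-k)$-dimensional complex linear subspaces of $\mathbb C^n$, let $\varkappa:\Omega^{(k)}\to\mathbb G_{n-k}(\mathbb C^n)$ be the map $\varkappa(\xi)=\ker D\Gamma(\xi)$, and let $\Omega^{\rm sing}$ be the set of all $\xi\in\mathbb C^n$ over which $\varkappa$ is not continuously extendible, i.e. such that $\varkappa(\eta)$ has no limit in $\mathbb G_{n-k}(\mathbb C^n)$ as $\eta\to\xi$, $\eta\in\Omega^{(k)}$.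 Then $\Omega^{\rm sing}$ is a nonempty complex analytic subset of $\mathbb C^n$ with $\dim\Omega^{\rm sing}=d$, the dimension being the maximum of the dimensions of $\Omega^{\rm sing}$ at its regular points. -/

import Mathlib

open Set Filter Topology

noncomputable section

namespace AffineFibration

/-- The space `ℂⁿ`. -/
abbrev Cn (n : ℕ) : Type := Fin n → ℂ

/-- The Grassmannian of `m`-dimensional complex linear subspaces of `ℂⁿ`. -/
def Gr (n m : ℕ) : Type := {W : Submodule ℂ (Cn n) // Module.finrank ℂ W = m}

/-- The `m`-frames of `ℂⁿ`: linearly independent `m`-tuples, with the topology of `(ℂⁿ)ᵐ`. -/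
abbrev Frame (n m : ℕ) : Type := {v : Fin m → Cn n // LinearIndependent ℂ v}

/-- The subspace spanned by a frame. -/
def frameSpan (n m : ℕ) (v : Frame n m) : Gr n m :=
  ⟨Submodule.span ℂ (Set.range v.1), by
    simpa using finrank_span_eq_card v.2⟩

/-- The standard topology of the Grassmannian: the quotient topology from the space of frames. -/
instance instTopologicalSpaceGr (n m : ℕ) : TopologicalSpace (Gr n m) :=
  TopologicalSpace.coinduced (frameSpan n m) inferInstance

/-- The rank of the derivative `DΓ(ξ)`. -/
def rankD {n : ℕ} (Γ : Cn n → Cn n) (ξ : Cn n) : ℕ :=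
  Module.finrank ℂ (LinearMap.range (fderiv ℂ Γ ξ : Cn n →ₗ[ℂ] Cn n))

/-- The set `Ω⁽ᵏ⁾` of points where `DΓ` has rank `k`. -/
def rankSet {n : ℕ} (Γ : Cn n → Cn n) (k : ℕ) : Set (Cn n) := {ξ | rankD Γ ξ = k}

/-- Condition (A1): `k` is the maximum of the rank of `DΓ`, and `1 ≤ k ≤ n - 1`. -/
def A1 {n : ℕ} (Γ : Cn n → Cn n) (k : ℕ) : Prop :=
  IsGreatest (Set.range (rankD Γ)) k ∧ 1 ≤ k ∧ k ≤ n - 1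

/-- Condition (A2): the level set of `Γ` through any point of `Ω⁽ᵏ⁾` is an affine subspace of
dimension `n - k`. -/
def A2 {n : ℕ} (Γ : Cn n → Cn n) (k : ℕ) : Prop :=
  ∀ ξ ∈ rankSet Γ k, ∃ A : AffineSubspace ℂ (Cn n),
    (A : Set (Cn n)) = {η | Γ η = Γ ξ} ∧ Module.finrank ℂ A.direction = n - k

/-- The map `ϰ : Ω⁽ᵏ⁾ → 𝔾_{n-k}(ℂⁿ)`, `ξ ↦ ker DΓ(ξ)`. -/
def kerMap {n : ℕ} (Γ : Cn n → Cn n) (k : ℕ) (ξ : rankSet Γ k) : Gr n (n - k) :=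
  ⟨LinearMap.ker (fderiv ℂ Γ ξ.1 : Cn n →ₗ[ℂ] Cn n), by
    have h1 := LinearMap.finrank_range_add_finrank_ker
      (fderiv ℂ Γ ξ.1 : Cn n →ₗ[ℂ] Cn n)
    have h2 : Module.finrank ℂ
      (LinearMap.range (fderiv ℂ Γ ξ.1 : Cn n →ₗ[ℂ] Cn n)) = k := ξ.2
    rw [h2, Module.finrank_fin_fun] at h1
    omega⟩

/-- `ϰ` is continuously extendible over `ξ`: it has a limit in the Grassmannian as its argument
tends to `ξ` inside `Ω⁽ᵏ⁾`. -/
def ExtendsOver {n : ℕ} (Γ : Cn n → Cn n) (k : ℕ) (ξ : Cn n) : Prop :=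
  ∃ L : Gr n (n - k),
    Tendsto (kerMap Γ k) (comap (Subtype.val : rankSet Γ k → Cn n) (𝓝 ξ)) (𝓝 L)

/-- The set `Ω^sing` of essential singularities, over which `ϰ` is not continuously extendible. -/
def singSet {n : ℕ} (Γ : Cn n → Cn n) (k : ℕ) : Set (Cn n) := {ξ | ¬ ExtendsOver Γ k ξ}

/-- Complex analytic subsets of `ℂⁿ`: locally, around each point of `ℂⁿ`, the common zeros of
finitely many holomorphic functions. -/
def IsAnalyticSet {n : ℕ} (S : Set (Cn n)) : Prop :=
  ∀ a : Cn n, ∃ U : Set (Cn n), IsOpen U ∧ a ∈ U ∧ ∃ (N : ℕ) (f : Fin N → Cn n → ℂ),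
    (∀ i, DifferentiableOn ℂ (f i) U) ∧ ∀ z ∈ U, z ∈ S ↔ ∀ i, f i z = 0

/-- `a ∈ S` is a regular point of dimension `p`: near `a`, the set `S` is a `p`-dimensional
complex submanifold, i.e. a biholomorphism from a neighbourhood of `a` onto an open set carries
`S` to a `p`-dimensional linear subspace. -/
def IsRegularPoint {n : ℕ} (S : Set (Cn n)) (a : Cn n) (p : ℕ) : Prop :=
  a ∈ S ∧ ∃ (e : OpenPartialHomeomorph (Cn n) (Cn n)) (W : Submodule ℂ (Cn n)),
    a ∈ e.source ∧ DifferentiableOn ℂ e e.source ∧ DifferentiableOn ℂ e.symm e.target ∧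
      Module.finrank ℂ W = p ∧ ∀ z ∈ e.source, z ∈ S ↔ e z ∈ W

/-- `S` is a (nonempty) complex analytic set of dimension `d`: the maximum of the dimensions of
`S` at its regular points is `d`. -/
def HasAnalyticDim {n : ℕ} (S : Set (Cn n)) (d : ℕ) : Prop :=
  IsAnalyticSet S ∧ IsGreatest {p : ℕ | ∃ a, IsRegularPoint S a p} d

end AffineFibration

end

namespace AffineFibration

variable {n m c p : ℕ}

/-! ### The Grassmannian is a T1 space -/

/-! With p = k - 1 and c = n - d, the map is Γ(z) = (z₀, …, z_{p-1}, ∑ z_{α j} z_{β j}), where the c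
indices α j lie below p and the β j do not. Once the first p coordinates are fixed, the last entry
is linear in the rest, so the fibres through points of rank k are affine. The kernel of DΓ(z) is cut
out of {w₀ = … = w_{p-1} = 0} by ∑ z_{α j} w_{β j} = 0, a nontrivial equation exactly off the
codimension c subspace {z_{α j} = 0 for all j}. Off that subspace the kernel varies continuously
(`extendsOver_truncPairing`). At its points, approach along the direction α j forces the limit w_{β
j} = 0 (`mem_limit_iff`); since c ≥ 2, two such limits disagree. Hence the singular set is this
subspace, of dimension n - c = d. -/

lemma frameSpan_eq_iff (v : Frame n m) (W : Gr n m) :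
    frameSpan n m v = W ↔ ∀ i, v.1 i ∈ W.1 := by
  constructor
  · rintro rfl i
    exact Submodule.subset_span ⟨i, rfl⟩
  · intro h
    refine Subtype.ext (Submodule.eq_of_le_of_finrank_eq ?_ ?_)
    · exact Submodule.span_le.2 (by rintro _ ⟨i, rfl⟩; exact h i)
    · rw [(frameSpan n m v).2, W.2]

lemma continuous_frameSpan : Continuous (frameSpan n m) :=
  continuous_coinduced_rng

/-- Being spanned by a frame of W is a closed condition on frames. T1 suffices later to identify the
limit of a constant map. -/
instance instT1SpaceGr : T1Space (Gr n m) := by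
  refine ⟨fun W => isClosed_coinduced.2 ?_⟩
  have : frameSpan n m ⁻¹' {W} = ⋂ i, {v : Frame n m | v.1 i ∈ W.1} := by
    ext v
    simp [frameSpan_eq_iff]
  rw [this]
  refine isClosed_iInter fun i => ?_
  exact (Submodule.closed_of_finiteDimensional W.1).preimage
    ((continuous_apply i).comp continuous_subtype_val)

/-! ### Dimension of linear subspaces as analytic sets -/

/-- A linear subspace has no regular points of dimension exceeding its linear dimension. -/
lemma IsRegularPoint.le_finrank {V : Submodule ℂ (Cn n)} {a : Cn n} {q : ℕ}
    (h : IsRegularPoint (V : Set (Cn n)) a q) : q ≤ Module.finrank ℂ V := by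
  obtain ⟨haV', e, W, ha, he, hes, rfl, hW⟩ := h
  have hb : e a ∈ e.target := e.map_source ha
  have haV : e.symm (e a) = a := e.left_inv ha
  have h1 : HasFDerivAt e (fderiv ℂ e a) (e.symm (e a)) := by
    rw [haV]
    exact (he.differentiableAt (e.open_source.mem_nhds ha)).hasFDerivAt
  have h2 : HasFDerivAt e.symm (fderiv ℂ e.symm (e a)) (e a) :=
    (hes.differentiableAt (e.open_target.mem_nhds hb)).hasFDerivAt
  have hid : (fderiv ℂ e a).comp (fderiv ℂ e.symm (e a)) = ContinuousLinearMap.id ℂ _ := by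
    refine (h1.comp (e a) h2).unique ((hasFDerivAt_id (e a)).congr_of_eventuallyEq ?_)
    filter_upwards [e.open_target.mem_nhds hb] with z hz using e.right_inv hz
  have haS : e a ∈ W := (hW a ha).1 haV'
  -- The curve t ↦ `e.symm (e a + t • w)` stays in V, so its difference quotients do, and V is
  -- closed.
  have hmaps : ∀ w ∈ W, fderiv ℂ e.symm (e a) w ∈ V := by
    intro w hw
    have hline : HasDerivAt (fun t : ℂ => e a + t • w) w 0 := by
      simpa using ((hasDerivAt_id (0 : ℂ)).smul_const w).const_add (e a)
    have h2' : HasFDerivAt e.symm (fderiv ℂ e.symm (e a)) (e a + (0 : ℂ) • w) := by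
      simpa using h2
    have hd := h2'.comp_hasDerivAt (0 : ℂ) hline
    have hlim := hd.tendsto_slope
    refine (Submodule.closed_of_finiteDimensional V).mem_of_tendsto hlim ?_
    have hev : ∀ᶠ t : ℂ in 𝓝 0, e a + t • w ∈ e.target := by
      refine hline.continuousAt.eventually_mem ?_
      simpa using e.open_target.mem_nhds hb
    have hV : ∀ t : ℂ, e a + t • w ∈ e.target → e.symm (e a + t • w) ∈ V := by
      intro t ht
      refine (hW _ (e.map_target ht)).2 ?_
      rw [e.right_inv ht]
      exact W.add_mem haS (W.smul_mem t hw)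
    filter_upwards [hev.filter_mono nhdsWithin_le_nhds] with t ht
    rw [slope_def_module]
    refine V.smul_mem _ (V.sub_mem (hV t ht) (hV 0 ?_))
    simpa using hb
  let L : W →ₗ[ℂ] V :=
    (fderiv ℂ e.symm (e a) : Cn n →ₗ[ℂ] Cn n).restrict hmaps
  refine LinearMap.finrank_le_finrank_of_injective (f := L) fun w w' hww => ?_
  have h3 : fderiv ℂ e.symm (e a) w = fderiv ℂ e.symm (e a) w' := congrArg Subtype.val hww
  have h4 := congrArg (fderiv ℂ e a) h3
  have h5 : ∀ x, fderiv ℂ e a (fderiv ℂ e.symm (e a) x) = x := fun x =>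
    DFunLike.congr_fun hid x
  rw [h5, h5] at h4
  exact Subtype.ext h4

/-- The coordinate subspace where the coordinates with index in the range of `f` vanish. -/
noncomputable def coordSubspace (f : Fin m → Fin n) : Submodule ℂ (Cn n) :=
  LinearMap.ker (LinearMap.funLeft ℂ ℂ f)

lemma mem_coordSubspace {f : Fin m → Fin n} {z : Cn n} :
    z ∈ coordSubspace f ↔ ∀ i, z (f i) = 0 := by
  simp [coordSubspace, funext_iff, LinearMap.funLeft_apply]

lemma finrank_coordSubspace {f : Fin m → Fin n} (hf : Function.Injective f) :
    Module.finrank ℂ (coordSubspace f) = n - m := by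
  have h := LinearMap.finrank_range_add_finrank_ker (LinearMap.funLeft ℂ ℂ f)
  rw [LinearMap.range_eq_top.2 (LinearMap.funLeft_surjective_of_injective ℂ ℂ f hf),
    finrank_top, Module.finrank_fin_fun, Module.finrank_fin_fun] at h
  exact Nat.eq_sub_of_add_eq' h

lemma hasAnalyticDim_coordSubspace {f : Fin m → Fin n} (hf : Function.Injective f) :
    HasAnalyticDim (coordSubspace f : Set (Cn n)) (n - m) := by
  refine ⟨fun a => ⟨univ, isOpen_univ, mem_univ a, m, fun i z => z (f i), fun i => ?_,
    fun z _ => mem_coordSubspace⟩, ⟨0, (coordSubspace f).zero_mem,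
    OpenPartialHomeomorph.refl _, coordSubspace f, mem_univ _, ?_, ?_,
    finrank_coordSubspace hf, fun z _ => Iff.rfl⟩, ?_⟩
  · exact (differentiable_apply (f i)).differentiableOn
  · exact differentiable_id.differentiableOn
  · exact differentiable_id.differentiableOn
  · rintro q ⟨a, ha⟩
    exact ha.le_finrank.trans_eq (finrank_coordSubspace hf)

/-! ### The map -/

/-- The linear functional `w ↦ ∑ j, z (α j) * w (β j)`. -/
noncomputable def pairing (α β : Fin c → Fin n) (z : Cn n) : Cn n →L[ℂ] ℂ :=
  ∑ j, z (α j) • ContinuousLinearMap.proj (R := ℂ) (φ := fun _ : Fin n => ℂ) (β j)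

lemma pairing_apply (α β : Fin c → Fin n) (z w : Cn n) :
    pairing α β z w = ∑ j, z (α j) * w (β j) := by
  simp [pairing]

/-- The linear map keeping the first `p` coordinates and replacing the others by zero. -/
noncomputable def trunc (n p : ℕ) : Cn n →L[ℂ] Cn n :=
  ContinuousLinearMap.pi fun i =>
    if (i : ℕ) < p then ContinuousLinearMap.proj (R := ℂ) (φ := fun _ : Fin n => ℂ) i else 0

lemma trunc_apply (z : Cn n) (i : Fin n) : trunc n p z i = if (i : ℕ) < p then z i else 0 := by
  by_cases h : (i : ℕ) < p <;> simp [trunc, h]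

lemma trunc_eq_zero_iff {z : Cn n} : trunc n p z = 0 ↔ ∀ i : Fin n, (i : ℕ) < p → z i = 0 := by
  simp [funext_iff, trunc_apply]

/-- The map `z ↦ (z₀, …, z_{p-1}, ∑ j, z (α j) * z (β j))`, with the last entry at index `i₀`. -/
noncomputable def truncPairing (p : ℕ) (α β : Fin c → Fin n) (i₀ : Fin n) (z : Cn n) : Cn n :=
  trunc n p z + pairing α β z z • Pi.single i₀ 1

lemma hasFDerivAt_truncPairing (α β : Fin c → Fin n) (i₀ : Fin n) (z : Cn n) :
    HasFDerivAt (truncPairing p α β i₀)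
      (trunc n p + (pairing α β z + pairing β α z).smulRight (Pi.single i₀ 1 : Cn n)) z := by
  have hq : HasFDerivAt (fun z : Cn n => pairing α β z z) (pairing α β z + pairing β α z) z := by
    have h : ∀ j ∈ Finset.univ, HasFDerivAt (fun z : Cn n => z (α j) * z (β j))
        (z (α j) • ContinuousLinearMap.proj (R := ℂ) (φ := fun _ : Fin n => ℂ) (β j) +
          z (β j) • ContinuousLinearMap.proj (R := ℂ) (φ := fun _ : Fin n => ℂ) (α j)) z :=
      fun j _ => (hasFDerivAt_apply (α j) z).mul (hasFDerivAt_apply (β j) z)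
    have hs := HasFDerivAt.fun_sum h
    rw [Finset.sum_add_distrib] at hs
    simp only [pairing_apply]
    exact hs
  exact (trunc n p).hasFDerivAt.add (hq.smul_const _)

lemma differentiable_truncPairing (α β : Fin c → Fin n) (i₀ : Fin n) :
    Differentiable ℂ (truncPairing p α β i₀) := fun z =>
  (hasFDerivAt_truncPairing α β i₀ z).differentiableAt

lemma trunc_add_smul_eq_iff {i₀ : Fin n} (hi₀ : p ≤ i₀) {z w : Cn n} {s t : ℂ} :
    trunc n p z + s • Pi.single i₀ 1 = trunc n p w + t • Pi.single i₀ 1 ↔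
      trunc n p (z - w) = 0 ∧ s = t := by
  constructor
  · intro h
    have hst : s = t := by
      simpa [trunc_apply, not_lt.2 hi₀] using congrFun h i₀
    subst hst
    rw [map_sub, sub_eq_zero]
    exact ⟨add_right_cancel h, rfl⟩
  · rintro ⟨h, rfl⟩
    rw [map_sub, sub_eq_zero] at h
    rw [h]

/-! ### Kernel, rank and level sets -/

section Fibration

variable {α β : Fin c → Fin n} {i₀ : Fin n}

/-- Kills the half of the product rule that differentiates the α factors. -/
lemma pairing_eq_zero_of_trunc (hα : ∀ j, (α j : ℕ) < p) {w : Cn n} (hw : trunc n p w = 0)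
    (z : Cn n) : pairing β α z w = 0 := by
  rw [pairing_apply]
  exact Finset.sum_eq_zero fun j _ => by rw [trunc_eq_zero_iff.1 hw _ (hα j), mul_zero]

lemma mem_ker_fderiv_truncPairing (hα : ∀ j, (α j : ℕ) < p) (hi₀ : p ≤ i₀) {z w : Cn n} :
    w ∈ LinearMap.ker (fderiv ℂ (truncPairing p α β i₀) z : Cn n →ₗ[ℂ] Cn n) ↔
      trunc n p w = 0 ∧ pairing α β z w = 0 := by
  have h := trunc_add_smul_eq_iff hi₀ (z := w) (w := 0) (s := pairing α β z w + pairing β α z w)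
    (t := 0)
  rw [LinearMap.mem_ker, (hasFDerivAt_truncPairing α β i₀ z).fderiv]
  simp only [map_zero, zero_smul, add_zero, sub_zero] at h
  refine h.trans (and_congr_right fun hw => ?_)
  rw [pairing_eq_zero_of_trunc hα hw, add_zero]

lemma finrank_ker_trunc (hp : p ≤ n) :
    Module.finrank ℂ (LinearMap.ker (trunc n p : Cn n →ₗ[ℂ] Cn n)) = n - p := by
  rw [← finrank_coordSubspace (Fin.castLE_injective hp)]
  have h : LinearMap.ker (trunc n p : Cn n →ₗ[ℂ] Cn n) = coordSubspace (Fin.castLE hp) := by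
    ext w
    rw [mem_coordSubspace, LinearMap.mem_ker]
    exact trunc_eq_zero_iff.trans ⟨fun h i => h _ i.2, fun h i hi => h ⟨i, hi⟩⟩
  rw [h]

lemma trunc_single {i : Fin n} (hi : p ≤ i) (a : ℂ) : trunc n p (Pi.single i a) = 0 := by
  refine trunc_eq_zero_iff.2 fun l hl => Pi.single_eq_of_ne ?_ _
  rintro rfl
  omega

lemma pairing_single (hβ : Function.Injective β) (z : Cn n) (j : Fin c) :
    pairing α β z (Pi.single (β j) 1) = z (α j) := by
  rw [pairing_apply, Finset.sum_eq_single j]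
  · simp
  · intro l _ hl
    rw [Pi.single_eq_of_ne (fun h => hl (hβ h)), mul_zero]
  · simp

lemma finrank_ker_fderiv_add_one (hα : ∀ j, (α j : ℕ) < p) (hβ : ∀ j, p ≤ β j)
    (hβi : Function.Injective β) (hi₀ : p ≤ i₀) {z : Cn n} (hz : z ∉ coordSubspace α) :
    Module.finrank ℂ (LinearMap.ker (fderiv ℂ (truncPairing p α β i₀) z : Cn n →ₗ[ℂ] Cn n)) + 1 =
      n - p := by
  have hp : p ≤ n := by have := i₀.2; omega
  set K := LinearMap.ker (trunc n p : Cn n →ₗ[ℂ] Cn n) with hK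
  let f : Module.Dual ℂ K := (pairing α β z : Cn n →ₗ[ℂ] ℂ).domRestrict K
  have hf : f ≠ 0 := by
    intro h0
    refine hz (mem_coordSubspace.2 fun j => ?_)
    have := DFunLike.congr_fun h0 ⟨Pi.single (β j) 1, trunc_single (hβ j) 1⟩
    exact (pairing_single hβi z j).symm.trans this
  have hmap : LinearMap.ker (fderiv ℂ (truncPairing p α β i₀) z : Cn n →ₗ[ℂ] Cn n) =
      (LinearMap.ker f).map K.subtype := by
    ext w
    rw [mem_ker_fderiv_truncPairing hα hi₀]
    constructor
    · rintro ⟨h1, h2⟩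
      exact ⟨⟨w, h1⟩, h2, rfl⟩
    · rintro ⟨w, h2, rfl⟩
      exact ⟨w.2, h2⟩
  rw [hmap, Submodule.finrank_map_subtype_eq, Module.Dual.finrank_ker_add_one_of_ne_zero hf,
    finrank_ker_trunc hp]

lemma rankD_add_finrank_ker (Γ : Cn n → Cn n) (z : Cn n) :
    rankD Γ z + Module.finrank ℂ (LinearMap.ker (fderiv ℂ Γ z : Cn n →ₗ[ℂ] Cn n)) = n := by
  simpa [rankD] using
    LinearMap.finrank_range_add_finrank_ker (fderiv ℂ Γ z : Cn n →ₗ[ℂ] Cn n)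

lemma rankD_truncPairing_of_notMem (hα : ∀ j, (α j : ℕ) < p) (hβ : ∀ j, p ≤ β j)
    (hβi : Function.Injective β) (hi₀ : p ≤ i₀) {z : Cn n} (hz : z ∉ coordSubspace α) :
    rankD (truncPairing p α β i₀) z = p + 1 := by
  have h1 := rankD_add_finrank_ker (truncPairing p α β i₀) z
  have h2 := finrank_ker_fderiv_add_one hα hβ hβi hi₀ hz
  have := i₀.2
  omega

lemma rankD_truncPairing_of_mem (hα : ∀ j, (α j : ℕ) < p) (hi₀ : p ≤ i₀)
    {z : Cn n} (hz : z ∈ coordSubspace α) :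
    rankD (truncPairing p α β i₀) z = p := by
  have hp : p ≤ n := by have := i₀.2; omega
  have h1 := rankD_add_finrank_ker (truncPairing p α β i₀) z
  have h2 : LinearMap.ker (fderiv ℂ (truncPairing p α β i₀) z : Cn n →ₗ[ℂ] Cn n) =
      LinearMap.ker (trunc n p : Cn n →ₗ[ℂ] Cn n) := by
    ext w
    rw [mem_ker_fderiv_truncPairing hα hi₀]
    refine and_iff_left ?_
    rw [pairing_apply]
    exact Finset.sum_eq_zero fun j _ => by rw [mem_coordSubspace.1 hz j, zero_mul]
  rw [h2, finrank_ker_trunc hp] at h1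
  omega

lemma mem_rankSet_truncPairing (hα : ∀ j, (α j : ℕ) < p) (hβ : ∀ j, p ≤ β j)
    (hβi : Function.Injective β) (hi₀ : p ≤ i₀) {z : Cn n} :
    z ∈ rankSet (truncPairing p α β i₀) (p + 1) ↔ z ∉ coordSubspace α := by
  refine ⟨fun h hz => ?_, rankD_truncPairing_of_notMem hα hβ hβi hi₀⟩
  have h' : rankD (truncPairing p α β i₀) z = p + 1 := h
  rw [rankD_truncPairing_of_mem hα hi₀ hz] at h'
  omega

lemma a1_truncPairing (hα : ∀ j, (α j : ℕ) < p) (hβ : ∀ j, p ≤ β j)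
    (hβi : Function.Injective β) (hi₀ : p ≤ i₀) (hc : 0 < c) (hpn : p + 1 ≤ n - 1) :
    A1 (truncPairing p α β i₀) (p + 1) := by
  refine ⟨⟨⟨Pi.single (α ⟨0, hc⟩) 1, rankD_truncPairing_of_notMem hα hβ hβi hi₀ fun h => ?_⟩, ?_⟩,
    by omega, hpn⟩
  · simpa using mem_coordSubspace.1 h ⟨0, hc⟩
  · rintro _ ⟨z, rfl⟩
    by_cases hz : z ∈ coordSubspace α
    · rw [rankD_truncPairing_of_mem hα hi₀ hz]
      omega
    · rw [rankD_truncPairing_of_notMem hα hβ hβi hi₀ hz]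

lemma a2_truncPairing (hα : ∀ j, (α j : ℕ) < p) (hi₀ : p ≤ i₀) :
    A2 (truncPairing p α β i₀) (p + 1) := by
  intro ξ hξ
  refine ⟨AffineSubspace.mk' ξ
    (LinearMap.ker (fderiv ℂ (truncPairing p α β i₀) ξ : Cn n →ₗ[ℂ] Cn n)), ?_, ?_⟩
  · ext η
    rw [SetLike.mem_coe, AffineSubspace.mem_mk', vsub_eq_sub, mem_ker_fderiv_truncPairing hα hi₀,
      mem_ofPred_eq, truncPairing, truncPairing, trunc_add_smul_eq_iff hi₀]
    refine and_congr_right fun h => ?_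
    -- The coefficients of the last entry are frozen along the fibre, so the quadratic equation
    -- becomes linear.
    have hα' : ∀ j, η (α j) = ξ (α j) := fun j =>
      sub_eq_zero.1 (trunc_eq_zero_iff.1 h _ (hα j))
    have : pairing α β η = pairing α β ξ := by simp only [pairing, hα']
    rw [this, map_sub, sub_eq_zero]
  · rw [AffineSubspace.direction_mk']
    exact (kerMap (truncPairing p α β i₀) (p + 1) ⟨ξ, hξ⟩).2

/-! ### Limits of the kernel map -/

lemma extendsOver_truncPairing (hα : ∀ j, (α j : ℕ) < p) (hβ : ∀ j, p ≤ β j)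
    (hβi : Function.Injective β) (hi₀ : p ≤ i₀) {ξ : Cn n} (hξ : ξ ∉ coordSubspace α) :
    ExtendsOver (truncPairing p α β i₀) (p + 1) ξ := by
  set Γ := truncPairing p α β i₀ with hΓ
  have hξk : ξ ∈ rankSet Γ (p + 1) := (mem_rankSet_truncPairing hα hβ hβi hi₀).2 hξ
  obtain ⟨j, hj⟩ : ∃ j, ξ (α j) ≠ 0 := by
    simpa [mem_coordSubspace] using hξ
  let K := (kerMap Γ (p + 1) ⟨ξ, hξk⟩).1
  let b : Module.Basis (Fin (n - (p + 1))) ℂ K :=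
    Module.finBasisOfFinrankEq ℂ K (kerMap Γ (p + 1) ⟨ξ, hξk⟩).2
  have hb : ∀ i, trunc n p (b i : Cn n) = 0 ∧ pairing α β ξ (b i : Cn n) = 0 := fun i =>
    (mem_ker_fderiv_truncPairing hα hi₀).1 (b i).2
  let s : Cn n := Pi.single (β j) 1
  have hs : ∀ η : Cn n, pairing α β η s = η (α j) := fun η => pairing_single hβi η j
  -- A basis of the kernel at ξ, corrected along `s` to lie in the kernel at η. It is independent
  -- for every η, even where division by zero gives 0, because the functional at ξ kills each `b i`
  -- but not `s`.
  let v : Cn n → Fin (n - (p + 1)) → Cn n := fun η i =>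
    (b i : Cn n) - (pairing α β η (b i : Cn n) / η (α j)) • s
  have hli : ∀ η, LinearIndependent ℂ (v η) := by
    intro η
    rw [Fintype.linearIndependent_iff]
    intro g hg
    have hg' : ∑ i, g i • (b i : Cn n) =
        (∑ i, g i * (pairing α β η (b i : Cn n) / η (α j))) • s := by
      simp only [v, smul_sub, Finset.sum_sub_distrib, smul_smul, ← Finset.sum_smul] at hg
      exact sub_eq_zero.1 hg
    have h0 := congrArg (pairing α β ξ) hg'
    rw [map_smul, hs, map_sum] at h0
    simp only [map_smul, (hb _).2, smul_zero, Finset.sum_const_zero] at h0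
    have ht := (smul_eq_zero.1 h0.symm).resolve_right hj
    rw [ht, zero_smul] at hg'
    refine Fintype.linearIndependent_iff.1 b.linearIndependent g (Subtype.ext ?_)
    simpa using hg'
  have hvcont : ContinuousAt v ξ := by
    refine continuousAt_pi.2 fun i => ?_
    have h1 : Continuous fun η : Cn n => pairing α β η (b i : Cn n) := by
      simp only [pairing_apply]
      fun_prop
    exact continuousAt_const.sub
      ((h1.continuousAt.div (continuous_apply (α j)).continuousAt hj).smul continuousAt_const)
  let F : Cn n → Frame n (n - (p + 1)) := fun η => ⟨v η, hli η⟩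
  have hF : ContinuousAt F ξ := hvcont.codRestrict hli
  refine ⟨frameSpan _ _ (F ξ), ?_⟩
  have hlim : Tendsto (fun η : rankSet Γ (p + 1) => frameSpan _ _ (F η.1))
      (comap Subtype.val (𝓝 ξ)) (𝓝 (frameSpan _ _ (F ξ))) :=
    (continuous_frameSpan.continuousAt.comp hF).tendsto.comp tendsto_comap
  refine hlim.congr' ?_
  have hne : ∀ᶠ η : Cn n in 𝓝 ξ, η (α j) ≠ 0 :=
    (continuous_apply (α j)).continuousAt.eventually_ne hj
  filter_upwards [tendsto_comap.eventually hne] with η hη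
  refine (frameSpan_eq_iff _ _).2 fun i => (mem_ker_fderiv_truncPairing hα hi₀).2 ⟨?_, ?_⟩
  · change trunc n p ((b i : Cn n) - _ • s) = 0
    rw [map_sub, map_smul, (hb i).1, trunc_single (hβ j), smul_zero, sub_zero]
  · change pairing α β η.1 ((b i : Cn n) - _ • s) = 0
    rw [map_sub, map_smul, hs, smul_eq_mul, div_mul_cancel₀ _ hη, sub_self]

/-- Approaching a point of `coordSubspace α` in the direction of the coordinate `α j`, the kernel
stays constant, so that it is the only possible limit. -/
lemma mem_limit_iff (hα : ∀ j, (α j : ℕ) < p) (hαi : Function.Injective α) (hβ : ∀ j, p ≤ β j)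
    (hβi : Function.Injective β) (hi₀ : p ≤ i₀) {ξ : Cn n} (hξ : ξ ∈ coordSubspace α)
    {L : Gr n (n - (p + 1))}
    (hL : Tendsto (kerMap (truncPairing p α β i₀) (p + 1))
      (comap (Subtype.val : rankSet (truncPairing p α β i₀) (p + 1) → Cn n) (𝓝 ξ)) (𝓝 L))
    (j : Fin c) (w : Cn n) : w ∈ L.1 ↔ trunc n p w = 0 ∧ w (β j) = 0 := by
  set Γ := truncPairing p α β i₀ with hΓ
  let γ : ℂ → Cn n := fun t => ξ + t • Pi.single (α j) 1
  have hpair : ∀ t w, pairing α β (γ t) w = t * w (β j) := by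
    intro t w
    rw [pairing_apply, Finset.sum_eq_single j]
    · simp [γ, mem_coordSubspace.1 hξ j]
    · intro l _ hl
      simp [γ, mem_coordSubspace.1 hξ l, hαi.ne hl]
    · simp
  have hγ : ∀ t : {t : ℂ // t ≠ 0}, γ t ∈ rankSet Γ (p + 1) := by
    intro t
    refine (mem_rankSet_truncPairing hα hβ hβi hi₀).2 fun h => t.2 ?_
    simpa [γ, mem_coordSubspace.1 hξ j] using mem_coordSubspace.1 h j
  let δ : {t : ℂ // t ≠ 0} → rankSet Γ (p + 1) := fun t => ⟨γ t, hγ t⟩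
  have hmem : ∀ t w, w ∈ (kerMap Γ (p + 1) (δ t)).1 ↔ trunc n p w = 0 ∧ w (β j) = 0 := by
    intro t w
    refine (mem_ker_fderiv_truncPairing hα hi₀).trans (and_congr_right fun _ => ?_)
    change pairing α β (γ t) w = 0 ↔ _
    rw [hpair, mul_eq_zero, or_iff_right t.2]
  let t₁ : {t : ℂ // t ≠ 0} := ⟨1, one_ne_zero⟩
  have hconst : ∀ t, kerMap Γ (p + 1) (δ t) = kerMap Γ (p + 1) (δ t₁) := fun t =>
    Subtype.ext (Submodule.ext fun w => (hmem t w).trans (hmem t₁ w).symm)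
  -- Without this the limit along the punctured line would be vacuous.
  have hne : (comap (Subtype.val : {t : ℂ // t ≠ 0} → ℂ) (𝓝 0)).NeBot := by
    refine comap_neBot_iff_frequently.2 ?_
    have : ∃ᶠ t : ℂ in 𝓝[≠] 0, t ≠ 0 :=
      (eventually_mem_nhdsWithin (s := ({0}ᶜ : Set ℂ))).frequently
    refine (this.filter_mono nhdsWithin_le_nhds).mono fun t ht => ⟨⟨t, ht⟩, rfl⟩
  have hδ : Tendsto δ (comap Subtype.val (𝓝 0)) (comap Subtype.val (𝓝 ξ)) := by
    refine tendsto_comap_iff.2 ?_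
    have hcont : Tendsto γ (𝓝 0) (𝓝 ξ) := by
      have : Continuous γ := by fun_prop
      simpa [γ] using this.tendsto 0
    exact hcont.comp tendsto_comap
  have hlim := hL.comp hδ
  have hfun : kerMap Γ (p + 1) ∘ δ = fun _ => kerMap Γ (p + 1) (δ t₁) := funext hconst
  rw [hfun, tendsto_const_nhds_iff] at hlim
  rw [← hlim, hmem]

lemma singSet_truncPairing (hα : ∀ j, (α j : ℕ) < p) (hαi : Function.Injective α)
    (hβ : ∀ j, p ≤ β j) (hβi : Function.Injective β) (hi₀ : p ≤ i₀) (hc : 2 ≤ c) :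
    singSet (truncPairing p α β i₀) (p + 1) = coordSubspace α := by
  ext ξ
  refine ⟨fun h => by_contra fun hξ => h (extendsOver_truncPairing hα hβ hβi hi₀ hξ), ?_⟩
  rintro hξ ⟨L, hL⟩
  let j₀ : Fin c := ⟨0, by omega⟩
  let j₁ : Fin c := ⟨1, by omega⟩
  have hj : j₀ ≠ j₁ := by simp [j₀, j₁]
  have h0 := mem_limit_iff hα hαi hβ hβi hi₀ hξ hL j₀ (Pi.single (β j₁) 1)
  have h1 := mem_limit_iff hα hαi hβ hβi hi₀ hξ hL j₁ (Pi.single (β j₁) 1)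
  -- The basis vector at β j₁ lies in the limit along α j₀ but not in the one along α j₁.
  have h := h1.1 (h0.2 ⟨trunc_single (hβ j₁) 1, Pi.single_eq_of_ne (hβi.ne hj) _⟩)
  simpa using h.2

end Fibration

end AffineFibration

open AffineFibration in
theorem theorem2 (n k d : ℕ) (hk : 3 ≤ k) (hkn : k ≤ n - 1)
    (hd : max (k - 1) (n - k + 1) ≤ d) (hdn : d ≤ n - 2) :
    ∃ Γ : AffineFibration.Cn n → AffineFibration.Cn n,
      Differentiable ℂ Γ ∧ AffineFibration.A1 Γ k ∧ AffineFibration.A2 Γ k ∧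
        AffineFibration.HasAnalyticDim (AffineFibration.singSet Γ k) d := by
  obtain ⟨hd1, hd2⟩ := max_le_iff.1 hd
  obtain ⟨p, rfl⟩ : ∃ p, k = p + 1 := ⟨k - 1, by omega⟩
  -- The bound n - k + 1 ≤ d keeps the α indices below p, k - 1 ≤ d keeps the β indices below n, and
  -- d ≤ n - 2 gives at least two pairs.
  let α : Fin (n - d) → Fin n := fun j => ⟨j, by omega⟩
  let β : Fin (n - d) → Fin n := fun j => ⟨p + j, by omega⟩
  let i₀ : Fin n := ⟨p, by omega⟩
  have hα : ∀ j, (α j : ℕ) < p := fun j => by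
    have := j.2
    simp only [α]
    omega
  have hαi : Function.Injective α := fun i j h => Fin.ext (by simpa [α] using h)
  have hβ : ∀ j, p ≤ β j := fun j => Nat.le_add_right p j
  have hβi : Function.Injective β := fun i j h => Fin.ext (by simpa [β] using h)
  refine ⟨truncPairing p α β i₀, differentiable_truncPairing α β i₀,
    a1_truncPairing hα hβ hβi le_rfl (by omega) hkn, a2_truncPairing hα le_rfl, ?_⟩
  rw [singSet_truncPairing hα hαi hβ hβi le_rfl (by omega)]
  have h := hasAnalyticDim_coordSubspace hαi
  rwa [show n - (n - d) = d by omega] at h
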